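/- Let $0<q<1$. Let ${\cal H}$ be the Hilbert space with orthonormal basis $e_{ij}^{(n)}$, $n\in\frac12{\mathbb N}$, $i,j\in\{-n,-n+1,\dots,n\}$, and let $\beta$ be the bounded operator (one of the standard generators of $SU_q(2)$ in the representation ${\cal H}$) $$\beta\, e_{ij}^{(n)} = b_+(n,i,j)\, e_{i+\frac12,\,j-\frac12}^{(n+\frac12)} + b_-(n,i,j)\, e_{i+\frac12,\,j-\frac12}^{(n-\frac12)},$$ $$b_+(n,i,j)=-q^{n+j}\,\frac{(1-q^{2n-2j+2})^{1/2}(1-q^{2n+2i+2})^{1/2}}{(1-q^{4n+2})^{1/2}(1-q^{4n+4})^{1/2}},\qquad b_-(n,i,j)=q^{n+i}\,\frac{(1-q^{2n+2j})^{1/2}(1-q^{2n-2i})^{1/2}}{(1-q^{4n})^{1/2}(1-q^{4n+2})^{1/2}},$$ where the second term is $0$ if $i=n$ or $j=-n$. Let $D$ be the self-adjoint diagonal operator with $D e_{ij}^{(n)}=2n\,e_{ij}^{(n)}$ if $i=n$ and $D e_{ij}^{(n)}=-2n\,e_{ij}^{(n)}$ if $i\neq n$. Let $P$ be the orthogonal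 projection on the closed span of the vectors $e_{nj}^{(n)}$, that is, $P=(1+F)/2$ with $F={\rm sign}\,D$ taken to be $1$ on the kernel ${\mathbb C}\,e_{00}^{(0)}$ of $D$; and let $|D|$ be given an arbitrary value $\varepsilon>0$ on this kernel. For a bounded operator $a$ such that $a\,P\,|D|^{-s}$ is of trace class for ${\rm Re}\,s>3$ and $s\mapsto{\rm Trace}(a\,P\,|D|^{-s})$ has a meromorphic continuation to ${\mathbb C}$ that is regular at $s=0$, let $\psi_0(a)=2\,{\rm Trace}(a\,P\,|D|^{-s})_{s=0}$ be twice the value of this continuation at $s=0$. Let $$G(x)=\sum_{n=1}^{\infty}\frac{n\,x^{n}}{1-x^{n}}\qquad(|x|<1).$$ Up to sign and an additive constant, $G$ is the logarithmic derivative of the Dedekind eta function $\eta=x^{1/24}\prod_{n\ge1}(1-x^n)$: with $x=e^{2\pi i\tau}$ and ${\rm Im}\,\tau>0$, $$\frac{1}{\eta}\,\frac{d\eta}{d\tau}=2\pi i\left(\frac1{24}-G(x)\right).$$ **Theorem 6.** For every integer $r\ge 1$ there is a rational function $R_r$, independent of $q$ and $\varepsilon$, whose poles in ${\mathbb C}$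 are all roots of unity, such that for all $q\in\,]0,1[$ and all $\varepsilon>0$ the value $\psi_0((\beta^*\beta)^r)$ is defined and $$\tfrac12\,\psi_0\big((\beta^*\beta)^r\big)=q^{-2r}\left(q^2R_r(q^2)-G(q^2)\right).$$ -/

import Mathlib

namespace SUq2

open Complex

/-- The index set of the orthonormal basis. The vector `e_{ij}^{(n)}` with
`n ∈ {0, 1/2, 1, …}` and `i, j ∈ {-n, -n+1, …, n}` has the label `(N, x, y)` with `N = 2n`,
`x = n + i` and `y = n + j`; thus `N ∈ ℕ` and `x, y ∈ {0, …, N}`. -/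
abbrev Idx : Type := Σ N : ℕ, Fin (N + 1) × Fin (N + 1)

/-- The Hilbert space with orthonormal basis `e_{ij}^{(n)}`. -/
abbrev H : Type := lp (fun _ : Idx => ℂ) 2

/-- The basis vector with label `k`. -/
noncomputable def e (k : Idx) : H := lp.single 2 k (1 : ℂ)

theorem memlp_weighted (σ : Idx ↪ Idx) (w : Idx → ℂ) (C : ℝ) (hC : ∀ k, ‖w k‖ ≤ C) (f : H) :
    Memℓp (fun k => w k * f (σ k)) 2 := by
  have hf : Summable fun k => ‖f (σ k)‖ ^ (2 : ℝ) := by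
    have := (lp.memℓp f).summable (by norm_num)
    simpa [Function.comp_def] using this.comp_injective σ.injective
  refine memℓp_gen ?_
  refine Summable.of_nonneg_of_le (fun k => by positivity) (fun k => ?_) (hf.mul_left (C ^ (2 : ℝ)))
  have h0 : 0 ≤ C := (norm_nonneg _).trans (hC k)
  simp only [ENNReal.toReal_ofNat]
  rw [norm_mul, Real.mul_rpow (norm_nonneg _) (norm_nonneg _)]
  gcongr
  exact hC k

/-- The bounded operator `f ↦ (k ↦ w k * f (σ k))` attached to an injection `σ` of the index set
and a bounded weight `w`; in other words `e_{σ k} ↦ w k • e_k`, and `e_l ↦ 0` for `l` not in the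
range of `σ`. -/
noncomputable def weightedPullback (σ : Idx ↪ Idx) (w : Idx → ℂ) (C : ℝ)
    (hC : ∀ k, ‖w k‖ ≤ C) : H →L[ℂ] H :=
  LinearMap.mkContinuous
    { toFun := fun f => ⟨fun k => w k * f (σ k), memlp_weighted σ w C hC f⟩
      map_add' := fun f g => by
        ext k
        exact mul_add (w k) (f (σ k)) (g (σ k))
      map_smul' := fun c f => by
        ext k
        simp [mul_left_comm] }
    C (fun f => by
      have h0 : 0 ≤ C := (norm_nonneg _).trans (hC ⟨0, 0, 0⟩)
      refine lp.norm_le_of_forall_sum_le (by norm_num) (by positivity) (fun s => ?_)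
      simp only [ENNReal.toReal_ofNat, LinearMap.coe_mk, AddHom.coe_mk]
      rw [Real.mul_rpow h0 (norm_nonneg _)]
      calc ∑ k ∈ s, ‖w k * f (σ k)‖ ^ (2 : ℝ)
          ≤ ∑ k ∈ s, C ^ (2 : ℝ) * ‖f (σ k)‖ ^ (2 : ℝ) := by
            refine Finset.sum_le_sum (fun k _ => ?_)
            rw [norm_mul, Real.mul_rpow (norm_nonneg _) (norm_nonneg _)]
            gcongr
            exact hC k
        _ = C ^ (2 : ℝ) * ∑ k ∈ s.map σ, ‖f k‖ ^ (2 : ℝ) := by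
            rw [Finset.sum_map, Finset.mul_sum]
        _ ≤ C ^ (2 : ℝ) * ‖f‖ ^ (2 : ℝ) := by
            gcongr
            simpa using lp.sum_rpow_le_norm_rpow (p := 2) (by norm_num) f (s.map σ))

theorem weightedPullback_apply (σ : Idx ↪ Idx) (w : Idx → ℂ) (C : ℝ)
    (hC : ∀ k, ‖w k‖ ≤ C) (f : H) (k : Idx) :
    (weightedPullback σ w C hC f : Idx → ℂ) k = w k * f (σ k) := rfl

/-- The coefficient `b_+(n,i,j)`, namely
`-q^(n+j) (1-q^(2n-2j+2))^(1/2) (1-q^(2n+2i+2))^(1/2) / ((1-q^(4n+2))^(1/2) (1-q^(4n+4))^(1/2))`,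
in terms of `N = 2n`, `x = n + i`, `y = n + j`. -/
noncomputable def bPlus (q : ℝ) (N x y : ℕ) : ℝ :=
  -q ^ y * (√(1 - q ^ (2 * (N - y) + 2)) * √(1 - q ^ (2 * x + 2))) /
    (√(1 - q ^ (2 * N + 2)) * √(1 - q ^ (2 * N + 4)))

/-- The coefficient `b_-(n,i,j)`, namely
`q^(n+i) (1-q^(2n+2j))^(1/2) (1-q^(2n-2i))^(1/2) / ((1-q^(4n))^(1/2) (1-q^(4n+2))^(1/2))`,
in terms of `N = 2n`, `x = n + i`, `y = n + j`. -/
noncomputable def bMinus (q : ℝ) (N x y : ℕ) : ℝ :=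
  q ^ x * (√(1 - q ^ (2 * y)) * √(1 - q ^ (2 * (N - x)))) /
    (√(1 - q ^ (2 * N)) * √(1 - q ^ (2 * N + 2)))

/-- `e_{ij}^{(n)} ↦ e_{i+1/2, j-1/2}^{(n+1/2)}` on labels: `(N, x, y) ↦ (N + 1, x + 1, y)`. -/
def shiftX : Idx ↪ Idx where
  toFun k := ⟨k.1 + 1, k.2.1.succ, k.2.2.castSucc⟩
  inj' := by
    rintro ⟨N, x, y⟩ ⟨N', x', y'⟩ h
    have hN : N = N' := by
      have := congrArg Sigma.fst h
      simpa using this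
    subst hN
    simpa using h

/-- `e_{ij}^{(n)} ↦ e_{i-1/2, j+1/2}^{(n+1/2)}` on labels: `(N, x, y) ↦ (N + 1, x, y + 1)`. -/
def shiftY : Idx ↪ Idx where
  toFun k := ⟨k.1 + 1, k.2.1.castSucc, k.2.2.succ⟩
  inj' := by
    rintro ⟨N, x, y⟩ ⟨N', x', y'⟩ h
    have hN : N = N' := by
      have := congrArg Sigma.fst h
      simpa using this
    subst hN
    simpa using h

theorem pow_mul_sqrt_div_le_one (q : ℝ) (h0 : 0 < q) (h1 : q < 1) (m a b c d : ℕ)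
    (hac : a ≤ c) (hbd : b ≤ d) :
    q ^ m * (√(1 - q ^ a) * √(1 - q ^ b)) / (√(1 - q ^ c) * √(1 - q ^ d)) ≤ 1 := by
  have ha : √(1 - q ^ a) ≤ √(1 - q ^ c) :=
    Real.sqrt_le_sqrt (sub_le_sub_left (pow_le_pow_of_le_one h0.le h1.le hac) 1)
  have hb : √(1 - q ^ b) ≤ √(1 - q ^ d) :=
    Real.sqrt_le_sqrt (sub_le_sub_left (pow_le_pow_of_le_one h0.le h1.le hbd) 1)
  refine div_le_one_of_le₀ ?_ (by positivity)
  calc q ^ m * (√(1 - q ^ a) * √(1 - q ^ b)) ≤ 1 * (√(1 - q ^ c) * √(1 - q ^ d)) := by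
        gcongr
        exact pow_le_one₀ h0.le h1.le
    _ = _ := one_mul _

theorem norm_bPlus_le (q : Set.Ioo (0 : ℝ) 1) (k : Idx) :
    ‖((bPlus q k.1 k.2.1 k.2.2 : ℝ) : ℂ)‖ ≤ 1 := by
  have h0 := q.2.1
  have hx := k.2.1.2
  rw [Complex.norm_real, bPlus, neg_mul, neg_div, norm_neg,
    Real.norm_of_nonneg (by positivity)]
  exact pow_mul_sqrt_div_le_one q h0 q.2.2 _ _ _ _ _ (by omega) (by omega)

theorem norm_bMinus_le (q : Set.Ioo (0 : ℝ) 1) (k : Idx) :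
    ‖((bMinus q (k.1 + 1) k.2.1 (k.2.2 + 1) : ℝ) : ℂ)‖ ≤ 1 := by
  have h0 := q.2.1
  have hy := k.2.2.2
  rw [Complex.norm_real, bMinus, Real.norm_of_nonneg (by positivity)]
  exact pow_mul_sqrt_div_le_one q h0 q.2.2 _ _ _ _ _ (by omega) (by omega)

/-- `β_+ e_{ij}^{(n)} = b_+(n,i,j) e_{i+1/2, j-1/2}^{(n+1/2)}`. -/
noncomputable def betaPlus (q : Set.Ioo (0 : ℝ) 1) : H →L[ℂ] H :=
  ContinuousLinearMap.adjoint
    (weightedPullback shiftX (fun k => (bPlus q k.1 k.2.1 k.2.2 : ℝ)) 1 (norm_bPlus_le q))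

/-- `β_- e_{ij}^{(n)} = b_-(n,i,j) e_{i+1/2, j-1/2}^{(n-1/2)}`. -/
noncomputable def betaMinus (q : Set.Ioo (0 : ℝ) 1) : H →L[ℂ] H :=
  weightedPullback shiftY (fun k => (bMinus q (k.1 + 1) k.2.1 (k.2.2 + 1) : ℝ)) 1
    (norm_bMinus_le q)

/-- The generator `β` of the coordinate algebra of `SU_q(2)`, acting in `H`. -/
noncomputable def beta (q : Set.Ioo (0 : ℝ) 1) : H →L[ℂ] H := betaPlus q + betaMinus q

/-- The basis vector with label `(N, x, y)`, and `0` if `(N, x, y)` is not a label. -/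
noncomputable def ev (N x y : ℕ) : H :=
  if h : x < N + 1 ∧ y < N + 1 then e ⟨N, ⟨x, h.1⟩, ⟨y, h.2⟩⟩ else 0

theorem e_apply (k l : Idx) : (e k : Idx → ℂ) l = if l = k then 1 else 0 := by
  classical
  rw [e, lp.coeFn_single, Pi.single_apply]

theorem inner_e (k : Idx) (f : H) : inner ℂ (e k) f = f k := by
  simp [e, lp.inner_single_left]

theorem betaPlus_e (q : Set.Ioo (0 : ℝ) 1) (k : Idx) :
    betaPlus q (e k) = ((bPlus q k.1 k.2.1 k.2.2 : ℝ) : ℂ) • e (shiftX k) := by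
  ext l
  rw [← inner_e, betaPlus, ContinuousLinearMap.adjoint_inner_right, ← inner_conj_symm, inner_e,
    weightedPullback_apply, e_apply, lp.coeFn_smul, Pi.smul_apply, e_apply]
  by_cases h : shiftX k = l
  · simp [h]
  · simp [h, Ne.symm h]

/-- The formula for `β` on the basis:
`β e_{ij}^{(n)} = b_+ e_{i+1/2, j-1/2}^{(n+1/2)} + b_- e_{i+1/2, j-1/2}^{(n-1/2)}`. -/
theorem beta_ev (q : Set.Ioo (0 : ℝ) 1) (N x y : ℕ) (hx : x ≤ N) (hy : y ≤ N) :
    beta q (ev N x y) = ((bPlus q N x y : ℝ) : ℂ) • ev (N + 1) (x + 1) y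
      + ((bMinus q N x y : ℝ) : ℂ) • ev (N - 1) x (y - 1) := by
  have hk : ev N x y = e ⟨N, ⟨x, by omega⟩, ⟨y, by omega⟩⟩ :=
    dif_pos (by omega)
  have hp : ev (N + 1) (x + 1) y = e (shiftX ⟨N, ⟨x, by omega⟩, ⟨y, by omega⟩⟩) :=
    dif_pos (by omega)
  rw [beta, _root_.add_apply, hk, betaPlus_e, hp]
  congr 1
  ext l
  rw [betaMinus, weightedPullback_apply, e_apply, lp.coeFn_smul, Pi.smul_apply, smul_eq_mul]
  obtain ⟨M, u, v⟩ := l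
  by_cases h : shiftY ⟨M, u, v⟩ = ⟨N, ⟨x, by omega⟩, ⟨y, by omega⟩⟩
  · rw [if_pos h, mul_one]
    have h1 : M + 1 = N := congrArg Sigma.fst h
    subst h1
    have h2 : u.castSucc = ⟨x, by omega⟩ ∧ v.succ = ⟨y, by omega⟩ :=
      Prod.mk.inj (eq_of_heq (Sigma.mk.inj h).2)
    have h3 : (u : ℕ) = x := by simpa using congrArg Fin.val h2.1
    have h4 : (v : ℕ) + 1 = y := by simpa using congrArg Fin.val h2.2
    subst h3 h4
    have hl : ev (M + 1 - 1) u (v + 1 - 1) = e ⟨M, u, v⟩ := dif_pos ⟨u.2, v.2⟩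
    rw [hl, e_apply, if_pos rfl, mul_one]
  · rw [if_neg h, mul_zero]
    by_cases hxy : x < N ∧ 0 < y
    · obtain ⟨N, rfl⟩ : ∃ N', N = N' + 1 := ⟨N - 1, by omega⟩
      obtain ⟨y, rfl⟩ : ∃ y', y = y' + 1 := ⟨y - 1, by omega⟩
      have hl : ev (N + 1 - 1) x (y + 1 - 1) = e ⟨N, ⟨x, by omega⟩, ⟨y, by omega⟩⟩ :=
        dif_pos (by omega)
      rw [hl, e_apply, if_neg, mul_zero]
      intro hM
      exact h (by rw [hM]; rfl)
    · have hb : bMinus q N x y = 0 := by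
        rcases not_and_or.mp hxy with hx' | hy'
        · obtain rfl : x = N := by omega
          simp [bMinus]
        · obtain rfl : y = 0 := by omega
          simp [bMinus]
      simp [hb]

/-- The sign `2 δ_0(n - i) - 1` of `D` on `e_{ij}^{(n)}`: it is `1` if `i = n` (in particular on
the kernel of `D`, spanned by `e_{00}^{(0)}`), and `-1` otherwise. -/
def fEigen (k : Idx) : ℝ :=
  if (k.2.1 : ℕ) = k.1 then 1 else -1

/-- The eigenvalue `(2 δ_0(n - i) - 1) 2n` of `D` on `e_{ij}^{(n)}`. -/
def dEigen (k : Idx) : ℝ := fEigen k * k.1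

open scoped Classical in
/-- The diagonal operator with `e_k ↦ d k • e_k`, for a bounded `d` (and `0` if `d` is not
bounded). -/
noncomputable def diagOp (d : Idx → ℂ) : H →L[ℂ] H :=
  if h : ∃ C : ℝ, ∀ k, ‖d k‖ ≤ C then
    weightedPullback (Function.Embedding.refl Idx) d h.choose h.choose_spec
  else 0

theorem diagOp_e (d : Idx → ℂ) (h : ∃ C : ℝ, ∀ k, ‖d k‖ ≤ C) (k : Idx) :
    diagOp d (e k) = d k • e k := by
  ext l
  rw [diagOp, dif_pos h, weightedPullback_apply, lp.coeFn_smul, Pi.smul_apply, smul_eq_mul,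
    Function.Embedding.refl_apply, e_apply]
  by_cases hl : l = k <;> simp [hl]

/-- The operator `F = sign D`. -/
noncomputable def F : H →L[ℂ] H := diagOp (fun k => (fEigen k : ℂ))

/-- The projection `P = (1 + F) / 2`. -/
noncomputable def P : H →L[ℂ] H := (1 / 2 : ℂ) • (1 + F)

/-- The eigenvalue of `|D|` on `e_k`, where the value on the kernel of `D` is replaced by an
arbitrary number `ε > 0`. -/
noncomputable def absDEigen (ε : ℝ) (k : Idx) : ℝ :=
  if dEigen k = 0 then ε else |dEigen k|

/-- The complex power `|D|^{-s}`, which is bounded for `Re s ≥ 0`. -/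
noncomputable def absDPow (ε : ℝ) (s : ℂ) : H →L[ℂ] H :=
  diagOp (fun k => (absDEigen ε k : ℂ) ^ (-s))

/-- Hilbert-Schmidt operators in `H`. -/
def IsHilbertSchmidt (T : H →L[ℂ] H) : Prop := Summable fun k => ‖T (e k)‖ ^ 2

/-- Trace class operators in `H`: the products of two Hilbert-Schmidt operators. -/
def IsTraceClass (T : H →L[ℂ] H) : Prop :=
  ∃ A B : H →L[ℂ] H, IsHilbertSchmidt A ∧ IsHilbertSchmidt B ∧ T = A * B

/-- The trace of a trace class operator. -/
noncomputable def trace (T : H →L[ℂ] H) : ℂ := ∑' k, inner ℂ (e k) (T (e k))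

/-- `Z` is the meromorphic continuation to `ℂ` of `s ↦ Trace (a P |D|^{-s})`, where `a P |D|^{-s}`
is of trace class for `Re s > 3`, and `Z` has no pole at `s = 0`. -/
structure IsEtaZeta (ε : ℝ) (a : H →L[ℂ] H) (Z : ℂ → ℂ) : Prop where
  meromorphic : Meromorphic Z
  analyticAt_zero : AnalyticAt ℂ Z 0
  isTraceClass : ∀ s : ℂ, 3 < s.re → IsTraceClass (a * P * absDPow ε s)
  eq_trace : ∀ s : ℂ, 3 < s.re → Z s = trace (a * P * absDPow ε s)

open scoped Classical in
/-- The `η`-cochain `ψ_0(a) = 2 Trace (a P |D|^{-s})_{s = 0}`. -/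
noncomputable def psi0 (ε : ℝ) (a : H →L[ℂ] H) : ℂ :=
  if h : ∃ Z, IsEtaZeta ε a Z then 2 * h.choose 0 else 0

/-- The value at `0` does not depend on the choice of the continuation. -/
theorem psi0_eq {ε : ℝ} {a : H →L[ℂ] H} {Z : ℂ → ℂ} (hZ : IsEtaZeta ε a Z) :
    psi0 ε a = 2 * Z 0 := by
  have h : ∃ Z, IsEtaZeta ε a Z := ⟨Z, hZ⟩
  rw [psi0, dif_pos h]
  congr 1
  obtain ⟨Y, hY, hYe⟩ : ∃ Y, IsEtaZeta ε a Y ∧ h.choose = Y := ⟨_, h.choose_spec, rfl⟩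
  rw [hYe]
  have hm : MeromorphicOn (Y - Z) Set.univ := fun z _ =>
    (hY.meromorphic z).sub (hZ.meromorphic z)
  have h4 : meromorphicOrderAt (Y - Z) 4 = ⊤ := by
    rw [meromorphicOrderAt_eq_top_iff]
    refine Filter.Eventually.filter_mono nhdsWithin_le_nhds ?_
    have ho : IsOpen {s : ℂ | 3 < s.re} := isOpen_lt continuous_const Complex.continuous_re
    filter_upwards [ho.mem_nhds (show (3 : ℝ) < (4 : ℂ).re by norm_num)] with s hs
    simp [hY.eq_trace s hs, hZ.eq_trace s hs]
  have h0 : meromorphicOrderAt (Y - Z) 0 = ⊤ := by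
    by_contra hne
    exact hm.meromorphicOrderAt_ne_top_of_isPreconnected isPreconnected_univ
      (Set.mem_univ _) (Set.mem_univ _) hne h4
  have ha : AnalyticAt ℂ (Y - Z) 0 := hY.analyticAt_zero.sub hZ.analyticAt_zero
  rw [meromorphicOrderAt_eq_top_iff] at h0
  have := (ha.frequently_zero_iff_eventually_zero.mp h0.frequently).self_of_nhds
  exact sub_eq_zero.mp this

/-- The function `G(x) = ∑_{n ≥ 1} n x^n / (1 - x^n)`, for `|x| < 1`. -/
noncomputable def G (x : ℂ) : ℂ := ∑' n : ℕ, ((n : ℂ) + 1) * x ^ (n + 1) / (1 - x ^ (n + 1))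

end SUq2

/-!
The operator `β` is normal, so `(β*β)^r = (β^r)* β^r`. On the range of `P`, the operator `β` is a
weighted shift `e_{nj}^{(n)} ↦ b_+ e_{n+1/2, j-1/2}^{(n+1/2)}`, hence the diagonal coefficients of
`(β*β)^r` there are products of values of `b_+²`. For fixed `N = 2n` they are summed in terms of
`x = q²`, and the sums converge to `(1 - x^r)⁻¹` exponentially fast as `N → ∞`. Therefore
`Trace ((β*β)^r P |D|^{-s})` is `(1 - x^r)⁻¹ (ε^{-s} + ζ(s))` plus an entire function, and, since
`ζ(0) = -1/2`, its value at `s = 0` is `(1 - x^r)⁻¹ / 2` plus the sum over `N` of the deviations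
from the limit. A `q`-Vandermonde identity yields a recursion in `r` for the deviations which,
summed over `N`, telescopes up to a rational function of `x`. For `r = 1` the deviations are the
terms with `n ≥ 2` of the Lambert series `G`, divided by `-x`.
-/

namespace SUq2

open Filter Topology Asymptotics Finset
open scoped ComplexConjugate

open EisensteinSeries UpperHalfPlane in
theorem logDeriv_eta_eq (τ : ℂ) (hτ : 0 < τ.im) :
    logDeriv ModularForm.eta τ =
      2 * Real.pi * Complex.I * (1 / 24 - G (Complex.exp (2 * Real.pi * Complex.I * τ))) := by
  have hG : ∀ x : ℂ, G x = ∑' n : ℕ+, (n : ℂ) ^ 1 * x ^ (n : ℕ) / (1 - x ^ (n : ℕ)) := fun x => by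
    simp only [pow_one, G,
      tsum_pnat_eq_tsum_succ (f := fun n : ℕ => (n : ℂ) * x ^ n / (1 - x ^ n)), Nat.cast_succ]
  refine (ModularForm.logDeriv_eta_eq_E2 ⟨τ, hτ⟩).trans ?_
  rw [E2_eq_tsum_cexp, hG, tsum_pow_div_one_sub_eq_tsum_sigma (norm_exp_two_pi_I_lt_one ⟨τ, hτ⟩)]
  ring

theorem meromorphic_riemannZeta : Meromorphic riemannZeta := fun s => by
  rcases eq_or_ne s 1 with rfl | hs
  · have h : MeromorphicAt (fun z => (z - 1)⁻¹ + riemannZeta₀ z) 1 :=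
      MeromorphicAt.add (by fun_prop) (differentiable_riemannZeta₀.analyticAt 1).meromorphicAt
    refine h.congr ?_
    filter_upwards [self_mem_nhdsWithin] with z hz using (riemannZeta_eq_inv_sub_add hz).symm
  · exact (analyticOn_riemannZeta s hs).meromorphicAt

section QSeries

variable {K : Type*} [Field K] {x : K}

theorem one_sub_pow_ne_zero (hx : ¬IsOfFinOrder x) {n : ℕ} (hn : n ≠ 0) : 1 - x ^ n ≠ 0 :=
  fun h => hx (isOfFinOrder_iff_pow_eq_one.mpr ⟨n, Nat.pos_of_ne_zero hn, (sub_eq_zero.mp h).symm⟩)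

/-- The `q`-Pochhammer symbol `(a; x)_r`, with base `x`. -/
def qPochhammer (a x : K) (r : ℕ) : K := ∏ t ∈ range r, (1 - a * x ^ t)

theorem qPochhammer_succ (a : K) (r : ℕ) :
    qPochhammer a x (r + 1) = qPochhammer a x r * (1 - a * x ^ r) :=
  prod_range_succ _ r

theorem qPochhammer_succ' (a : K) (r : ℕ) :
    qPochhammer a x (r + 1) = (1 - a) * qPochhammer (a * x) x r := by
  simp only [qPochhammer, prod_range_succ', pow_zero, mul_one, pow_succ', mul_assoc,
    mul_comm (1 - a)]

theorem qPochhammer_pow_mul (x : K) (r n : ℕ) :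
    qPochhammer (x ^ n) x r * (1 - x ^ (n + r)) =
      (1 - x ^ n) * qPochhammer (x ^ (n + 1)) x r := by
  rw [pow_add, ← qPochhammer_succ, qPochhammer_succ', pow_succ]

theorem qPochhammer_pow_ne_zero (hx : ¬IsOfFinOrder x) {n : ℕ} (hn : n ≠ 0) (r : ℕ) :
    qPochhammer (x ^ n) x r ≠ 0 :=
  prod_ne_zero_iff.mpr fun t _ => by
    rw [← pow_add]
    exact one_sub_pow_ne_zero hx (by lia)

/-- The sum `∑_{y + m = N} x^(s y) (x^(m+1); x)_r`. -/
def pochhammerSum (x : K) (r s N : ℕ) : K :=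
  ∑ p ∈ antidiagonal N, x ^ (p.1 * s) * qPochhammer (x ^ (p.2 + 1)) x r

theorem pochhammerSum_zero (x : K) (r s : ℕ) : pochhammerSum x r s 0 = qPochhammer x x r := by
  simp [pochhammerSum]

theorem pochhammerSum_succ (x : K) (r s N : ℕ) :
    pochhammerSum x r s (N + 1) =
      qPochhammer (x ^ (N + 2)) x r + x ^ s * pochhammerSum x r s N := by
  rw [pochhammerSum, Nat.sum_antidiagonal_succ, zero_mul, pow_zero, one_mul, pochhammerSum,
    mul_sum]
  exact congrArg _ (sum_congr rfl fun p _ => by ring)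

theorem pochhammerSum_succ_left (x : K) (r s N : ℕ) :
    pochhammerSum x (r + 1) (s + 1) N =
      pochhammerSum x r (s + 1) N - x ^ (N + 1 + r) * pochhammerSum x r s N := by
  simp only [pochhammerSum, mul_sum, ← sum_sub_distrib]
  refine sum_congr rfl fun p hp => ?_
  rw [qPochhammer_succ, ← mem_antidiagonal.mp hp]
  ring

/-- A case of the `q`-Chu–Vandermonde summation. -/
theorem pochhammerSum_mul_one_sub (x : K) (r N : ℕ) :
    pochhammerSum x r (r + 1) N * (1 - x ^ (r + 1)) =
      (1 - x ^ (N + 1)) * qPochhammer (x ^ (N + 2)) x r := by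
  induction N with
  | zero => simpa [pochhammerSum_zero, add_comm] using qPochhammer_pow_mul x r 1
  | succ N ih =>
    rw [pochhammerSum_succ]
    linear_combination x ^ (r + 1) * ih + qPochhammer_pow_mul x r (N + 2)

/-- The sum over the basis vectors with labels `(N, N, y)` of the `r`-th moments of the spectral
measures of `β*β` at them, where `x = q²`. -/
def momentSum (x : K) (r N : ℕ) : K := pochhammerSum x r r N / qPochhammer (x ^ (N + 2)) x r

theorem momentSum_zero_left (x : K) (N : ℕ) : momentSum x 0 N = N + 1 := by
  simp [momentSum, pochhammerSum, qPochhammer]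

theorem momentSum_zero_right (hx : ¬IsOfFinOrder x) (r : ℕ) :
    momentSum x r 0 = (1 - x) / (1 - x ^ (r + 1)) := by
  have hr := one_sub_pow_ne_zero hx r.succ_ne_zero
  have hP := qPochhammer_pow_ne_zero hx two_ne_zero r
  have := pochhammerSum_mul_one_sub x r 0
  rw [pochhammerSum_zero, zero_add, zero_add, pow_one] at this
  rw [momentSum, pochhammerSum_zero, div_eq_div_iff hP hr, this]

theorem momentSum_succ_left (hx : ¬IsOfFinOrder x) (r N : ℕ) :
    momentSum x (r + 1) N = ((1 - x ^ (N + 1)) / (1 - x ^ (r + 1)) -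
      x ^ (N + 1 + r) * momentSum x r N) / (1 - x ^ (N + 2 + r)) := by
  have hr := one_sub_pow_ne_zero hx r.succ_ne_zero
  have hN := one_sub_pow_ne_zero hx (n := N + 2 + r) (by lia)
  have hP := qPochhammer_pow_ne_zero hx (N + 1).succ_ne_zero r
  rw [momentSum, momentSum, pochhammerSum_succ_left, qPochhammer_succ, ← pow_add,
    eq_div_of_mul_eq hr (pochhammerSum_mul_one_sub x r N)]
  field_simp

theorem momentSum_succ_right (hx : ¬IsOfFinOrder x) (r N : ℕ) :
    momentSum x r (N + 1) =
      (1 - x ^ (N + 2)) * (1 + x ^ r * momentSum x r N) / (1 - x ^ (N + 2 + r)) := by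
  have hN := one_sub_pow_ne_zero hx (n := N + 2 + r) (by lia)
  have hP := qPochhammer_pow_ne_zero hx (N + 1).succ_ne_zero r
  have hP' := qPochhammer_pow_ne_zero hx (N + 2).succ_ne_zero r
  have shift := qPochhammer_pow_mul x r (N + 2)
  rw [momentSum, momentSum, pochhammerSum_succ, div_eq_div_iff hP' hN]
  field_simp
  linear_combination (qPochhammer (x ^ (N + 2)) x r + x ^ r * pochhammerSum x r r N) * shift

/-- The difference between `momentSum x r N` and its limit as `N → ∞`. -/
def deviation (x : K) (r N : ℕ) : K := momentSum x r N - (1 - x ^ r)⁻¹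

theorem deviation_one (hx : ¬IsOfFinOrder x) (N : ℕ) :
    deviation x 1 N = -((N + 2) * x ^ (N + 1) / (1 - x ^ (N + 2))) := by
  have h1 := one_sub_pow_ne_zero hx one_ne_zero
  have hN := one_sub_pow_ne_zero hx (N + 1).succ_ne_zero
  rw [pow_one] at h1
  rw [deviation, momentSum_succ_left hx 0, momentSum_zero_left]
  simp only [zero_add, add_zero, pow_one]
  field_simp
  ring

/-- The last term telescopes when summed over `N`, so that the sums of the deviations for `r + 1`
and for `r` differ by a rational function of `x`. -/
theorem pow_mul_deviation_succ (hx : ¬IsOfFinOrder x) {r : ℕ} (hr : r ≠ 0) (N : ℕ) :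
    x ^ (r + 1) * deviation x (r + 1) N =
      x ^ r * deviation x r N -
        x ^ r * (1 - x ^ r)⁻¹ * (deviation x r N - deviation x r (N + 1)) := by
  have h1 := one_sub_pow_ne_zero hx hr
  have h2 := one_sub_pow_ne_zero hx r.succ_ne_zero
  have h3 := one_sub_pow_ne_zero hx (n := N + 2 + r) (by lia)
  simp only [deviation, momentSum_succ_right hx r N, momentSum_succ_left hx r N]
  generalize momentSum x r N = c
  field_simp
  ring

theorem deviation_zero_right (hx : ¬IsOfFinOrder x) (r : ℕ) :
    deviation x r 0 = (1 - x) * (1 - x ^ (r + 1))⁻¹ - (1 - x ^ r)⁻¹ := by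
  rw [deviation, momentSum_zero_right hx, div_eq_mul_inv]

end QSeries

section RationalFunctions

variable {K : Type*} [Field K]

/-- The ring of the rational functions whose poles all lie in `S`. -/
def polesIn (S : Set K) : Subring (RatFunc K) where
  carrier := {R | ∀ z, R.denom.eval z = 0 → z ∈ S}
  zero_mem' := by simp
  one_mem' := by simp
  add_mem' {R T} hR hT z hz := by
    have := Polynomial.eval_eq_zero_of_dvd_of_eval_eq_zero (RatFunc.denom_add_dvd R T) hz
    rw [Polynomial.eval_mul, mul_eq_zero] at this
    exact this.elim (hR z) (hT z)
  mul_mem' {R T} hR hT z hz := by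
    have := Polynomial.eval_eq_zero_of_dvd_of_eval_eq_zero (RatFunc.denom_mul_dvd R T) hz
    rw [Polynomial.eval_mul, mul_eq_zero] at this
    exact this.elim (hR z) (hT z)
  neg_mem' {R} hR z hz := by
    have hdvd : (-R).denom ∣ R.denom :=
      (RatFunc.denom_dvd R.denom_ne_zero).mpr ⟨-R.num, by
        rw [map_neg, neg_div, RatFunc.num_div_denom]⟩
    exact hR z (Polynomial.eval_eq_zero_of_dvd_of_eval_eq_zero hdvd hz)

/-- Evaluation, at a point outside `S`, of the rational functions whose poles all lie in `S`. -/
noncomputable def evalHom (S : Set K) {z : K} (hz : z ∉ S) : polesIn S →+* K where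
  toFun R := (R : RatFunc K).eval (RingHom.id K) z
  map_zero' := RatFunc.eval_zero _ _
  map_one' := RatFunc.eval_one _ _
  map_add' R T := RatFunc.eval_add _ _ (fun h => hz (R.2 z h)) (fun h => hz (T.2 z h))
  map_mul' R T := RatFunc.eval_mul _ _ (fun h => hz (R.2 z h)) (fun h => hz (T.2 z h))

theorem algebraMap_mem_polesIn (S : Set K) (p : Polynomial K) :
    algebraMap (Polynomial K) (RatFunc K) p ∈ polesIn S := fun z hz => by
  simp at hz

/-- The inclusion of the polynomials in the rational functions whose poles all lie in `S`. -/
noncomputable def ofPolynomial (S : Set K) : Polynomial K →+* polesIn S :=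
  (algebraMap (Polynomial K) (RatFunc K)).codRestrict (polesIn S) (algebraMap_mem_polesIn S)

theorem evalHom_ofPolynomial {S : Set K} {z : K} (hz : z ∉ S) (p : Polynomial K) :
    evalHom S hz (ofPolynomial S p) = p.eval z := RatFunc.eval_algebraMap _ _ p

/-- The rational function `1 / (1 - X ^ (n + 1))`, whose poles are roots of unity. -/
noncomputable def invOneSubPow (K : Type*) [Field K] (n : ℕ) : polesIn {z : K | IsOfFinOrder z} :=
  ⟨(algebraMap (Polynomial K) (RatFunc K) (1 - Polynomial.X ^ (n + 1)))⁻¹, fun z hz => by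
    rw [← one_div, ← map_one (algebraMap (Polynomial K) (RatFunc K))] at hz
    have hroot := Polynomial.eval_eq_zero_of_dvd_of_eval_eq_zero
      (RatFunc.denom_div_dvd 1 (1 - Polynomial.X ^ (n + 1))) hz
    simp only [Polynomial.eval_sub, Polynomial.eval_one, Polynomial.eval_pow, Polynomial.eval_X,
      sub_eq_zero] at hroot
    exact isOfFinOrder_iff_pow_eq_one.mpr ⟨n + 1, n.succ_pos, hroot.symm⟩⟩

theorem evalHom_invOneSubPow {z : K} (hz : z ∉ {z : K | IsOfFinOrder z}) (n : ℕ) :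
    evalHom _ hz (invOneSubPow K n) = (1 - z ^ (n + 1))⁻¹ := by
  have heval : (1 - Polynomial.X ^ (n + 1) : Polynomial K).eval z = 1 - z ^ (n + 1) := by simp
  have hne : (1 - Polynomial.X ^ (n + 1) : Polynomial K) ≠ 0 := fun h =>
    one_sub_pow_ne_zero hz n.succ_ne_zero (by rw [← heval, h, Polynomial.eval_zero])
  have hmul : invOneSubPow K n * ofPolynomial _ (1 - Polynomial.X ^ (n + 1)) = 1 :=
    Subtype.ext (inv_mul_cancel₀ (RatFunc.algebraMap_ne_zero hne))
  refine eq_inv_of_mul_eq_one_left ?_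
  rw [← heval, ← evalHom_ofPolynomial hz, ← map_mul, hmul, map_one]

end RationalFunctions

section RapidDecay

theorem not_isOfFinOrder_of_norm_lt_one {K : Type*} [NormedDivisionRing K] {x : K}
    (hx : ‖x‖ < 1) : ¬IsOfFinOrder x :=
  fun h => hx.ne h.norm_eq_one

theorem isBigO_deviation {x : ℂ} (hx0 : x ≠ 0) (hx : ‖x‖ < 1) {ρ : ℝ} (hρ : ‖x‖ < ρ) {r : ℕ}
    (hr : 1 ≤ r) : deviation x r =O[atTop] fun N => ρ ^ N := by
  have hfin := not_isOfFinOrder_of_norm_lt_one hx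
  induction r, hr using Nat.le_induction with
  | base =>
    have hpow : Tendsto (fun N : ℕ => (1 - x ^ (N + 2))⁻¹) atTop (𝓝 (1 - 0)⁻¹) :=
      (((tendsto_pow_atTop_nhds_zero_of_norm_lt_one hx).comp
        (tendsto_add_atTop_nat 2)).const_sub 1).inv₀ (by simp)
    have hlin := (isLittleO_pow_const_mul_const_pow_const_pow_of_norm_lt 1 hρ).isBigO
    have hconst := (isLittleO_pow_const_mul_const_pow_const_pow_of_norm_lt 0 hρ).isBigO
    refine (((hlin.add (hconst.const_mul_left 2)).mul (hpow.isBigO_one ℝ)).const_mul_left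
      (-x)).congr (fun N => ?_) fun N => mul_one _
    rw [deviation_one hfin]
    ring
  | succ r hr ih =>
    have hshift : (fun N => deviation x r (N + 1)) =O[atTop] fun N => ρ ^ N := by
      refine (ih.comp_tendsto (tendsto_add_atTop_nat 1)).trans ?_
      simpa only [pow_succ', Function.comp_def] using isBigO_const_mul_self ρ _ atTop
    refine ((ih.sub ((ih.sub hshift).const_mul_left (1 - x ^ r)⁻¹)).const_mul_left x⁻¹).congr_left
      fun N => ?_
    have h := pow_mul_deviation_succ hfin (Nat.one_le_iff_ne_zero.mp hr) N
    rw [inv_mul_eq_iff_eq_mul₀ hx0, ← mul_right_inj' (pow_ne_zero r hx0), mul_sub, ← mul_assoc,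
      ← mul_assoc, ← pow_succ, h]

theorem abscissaOfAbsConv_eq_bot_of_isBigO_pow {f : ℕ → ℂ} {ρ : ℝ} (hρ0 : 0 < ρ) (hρ : ρ < 1)
    (hf : f =O[atTop] fun n => ρ ^ n) : LSeries.abscissaOfAbsConv f = ⊥ := by
  have hexp : (fun n : ℕ => ρ ^ n) = fun n : ℕ => Real.exp (-(-Real.log ρ) * n) := by
    funext n
    rw [neg_neg, mul_comm, Real.exp_nat_mul, Real.exp_log hρ0]
  refine EReal.eq_bot_iff_forall_lt _ |>.mpr fun y => ?_
  have hrpow : f =O[atTop] fun n : ℕ => (n : ℝ) ^ (y - 2) := by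
    rw [hexp] at hf
    exact hf.trans ((isLittleO_exp_neg_mul_rpow_atTop (neg_pos.mpr (Real.log_neg hρ0 hρ))
      _).comp_tendsto tendsto_natCast_atTop_atTop).isBigO
  refine (LSeries.abscissaOfAbsConv_le_of_isBigO_rpow hrpow).trans_lt ?_
  exact_mod_cast (by linarith : y - 2 + 1 < y)

theorem abscissaOfAbsConv_deviation {x : ℂ} (hx0 : x ≠ 0) (hx : ‖x‖ < 1) {r : ℕ} (hr : 1 ≤ r) :
    LSeries.abscissaOfAbsConv (deviation x r) = ⊥ := by
  obtain ⟨ρ, hxρ, hρ⟩ := exists_between hx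
  exact abscissaOfAbsConv_eq_bot_of_isBigO_pow ((norm_nonneg x).trans_lt hxρ) hρ
    (isBigO_deviation hx0 hx hxρ hr)

theorem summable_of_abscissaOfAbsConv_lt_zero {f : ℕ → ℂ} (h : LSeries.abscissaOfAbsConv f < 0) :
    Summable f := by
  have hL : LSeriesSummable f 0 := LSeriesSummable_of_abscissaOfAbsConv_lt_re (by simpa using h)
  refine (summable_nat_add_iff 1).mp (((summable_nat_add_iff 1).mpr hL).congr fun n => ?_)
  simp [LSeries.term_of_ne_zero]

theorem LSeries_zero_of_abscissaOfAbsConv_lt_zero {f : ℕ → ℂ}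
    (h : LSeries.abscissaOfAbsConv f < 0) : LSeries f 0 = ∑' n, f (n + 1) := by
  have hL : LSeriesSummable f 0 := LSeriesSummable_of_abscissaOfAbsConv_lt_re (by simpa using h)
  rw [LSeries, hL.tsum_eq_zero_add, LSeries.term_zero, zero_add]
  simp [LSeries.term_of_ne_zero]

end RapidDecay

section RegularizedSum

variable {x : ℂ}

theorem summable_deviation (hx0 : x ≠ 0) (hx : ‖x‖ < 1) {r : ℕ} (hr : 1 ≤ r) :
    Summable (deviation x r) :=
  summable_of_abscissaOfAbsConv_lt_zero <|
    (abscissaOfAbsConv_deviation hx0 hx hr).trans_lt EReal.bot_lt_zero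

theorem tsum_deviation_one (hx : ‖x‖ < 1) :
    x * ∑' N, deviation x 1 N = x * (1 - x)⁻¹ - G x := by
  have hsum : Summable fun n : ℕ => ((n : ℂ) + 1) * x ^ (n + 1) / (1 - x ^ (n + 1)) := by
    have h := summable_norm_pow_mul_geometric_div_one_sub 1 hx
    exact ((summable_nat_add_iff 1).mpr h).congr fun n => by rw [pow_one, Nat.cast_succ]
  have hterm : ∀ N : ℕ, x * deviation x 1 N =
      -((((N + 1 : ℕ) : ℂ) + 1) * x ^ (N + 1 + 1) / (1 - x ^ (N + 1 + 1))) := fun N => by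
    rw [deviation_one (not_isOfFinOrder_of_norm_lt_one hx)]
    push_cast
    ring
  rw [← tsum_mul_left, tsum_congr hterm, tsum_neg, G, hsum.tsum_eq_zero_add]
  simp [div_eq_mul_inv]

theorem pow_mul_tsum_deviation_succ (hx0 : x ≠ 0) (hx : ‖x‖ < 1) {r : ℕ} (hr : 1 ≤ r) :
    x ^ (r + 1) * ∑' N, deviation x (r + 1) N =
      x ^ r * ∑' N, deviation x r N - x ^ r * (1 - x ^ r)⁻¹ * deviation x r 0 := by
  have hsum := summable_deviation hx0 hx hr
  have hsum' := (summable_nat_add_iff 1).mpr hsum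
  have hfin := not_isOfFinOrder_of_norm_lt_one hx
  rw [← tsum_mul_left, tsum_congr (pow_mul_deviation_succ hfin (Nat.one_le_iff_ne_zero.mp hr)),
    (hsum.mul_left _).tsum_sub ((hsum.sub hsum').mul_left _), tsum_mul_left, tsum_mul_left,
    hsum.tsum_sub hsum', hsum.tsum_eq_zero_add, add_sub_cancel_right]

theorem pow_mul_tsum_deviation (hx0 : x ≠ 0) (hx : ‖x‖ < 1) (s : ℕ) :
    x ^ (s + 1) * ∑' N, deviation x (s + 1) N = x * (1 - x)⁻¹ - G x -
      ∑ j ∈ range s, x ^ (j + 1) * (1 - x ^ (j + 1))⁻¹ * deviation x (j + 1) 0 := by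
  induction s with
  | zero => simp [tsum_deviation_one hx]
  | succ s ih =>
    rw [pow_mul_tsum_deviation_succ hx0 hx s.succ_pos, ih, sum_range_succ, sub_sub]

/-- The rational function `R_{s+1}` of the theorem. -/
noncomputable def etaRatFunc (s : ℕ) : polesIn {z : ℂ | IsOfFinOrder z} :=
  ofPolynomial _ (Polynomial.C (1 / 2) * Polynomial.X ^ s) * invOneSubPow ℂ s + invOneSubPow ℂ 0 -
    ∑ j ∈ range s, ofPolynomial _ (Polynomial.X ^ j) * invOneSubPow ℂ j *
      (ofPolynomial _ (1 - Polynomial.X) * invOneSubPow ℂ (j + 1) - invOneSubPow ℂ j)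

theorem pow_mul_regularizedSum (hx0 : x ≠ 0) (hx : ‖x‖ < 1) (s : ℕ) :
    x ^ (s + 1) * (1 / 2 * (1 - x ^ (s + 1))⁻¹ + ∑' N, deviation x (s + 1) N) =
      x * (etaRatFunc s : RatFunc ℂ).eval (RingHom.id ℂ) x - G x := by
  have hfin : x ∉ {z : ℂ | IsOfFinOrder z} := not_isOfFinOrder_of_norm_lt_one hx
  have heval : (etaRatFunc s : RatFunc ℂ).eval (RingHom.id ℂ) x =
      1 / 2 * x ^ s * (1 - x ^ (s + 1))⁻¹ + (1 - x)⁻¹ -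
        ∑ j ∈ range s, x ^ j * (1 - x ^ (j + 1))⁻¹ * deviation x (j + 1) 0 := by
    change evalHom _ hfin (etaRatFunc s) = _
    simp [etaRatFunc, evalHom_ofPolynomial, evalHom_invOneSubPow, deviation_zero_right hfin]
  rw [heval, mul_add, pow_mul_tsum_deviation hx0 hx, mul_sub, mul_sum]
  have hterm : ∀ j, x * (x ^ j * (1 - x ^ (j + 1))⁻¹ * deviation x (j + 1) 0) =
    x ^ (j + 1) * (1 - x ^ (j + 1))⁻¹ * deviation x (j + 1) 0 := fun j => by ring
  simp only [hterm]
  ring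

end RegularizedSum

section Operators

theorem clm_ext_e {S T : H →L[ℂ] H} (h : ∀ k, S (e k) = T (e k)) : S = T :=
  lp.ext_continuousLinearMap (by norm_num) fun k => by
    ext1
    exact h k

variable {σ τ : Idx ↪ Idx} {w v : Idx → ℂ} {C D : ℝ}

theorem adjoint_weightedPullback_e (hC : ∀ k, ‖w k‖ ≤ C) (k : Idx) :
    ContinuousLinearMap.adjoint (weightedPullback σ w C hC) (e k) = conj (w k) • e (σ k) := by
  ext l
  rw [← inner_e, ContinuousLinearMap.adjoint_inner_right, ← inner_conj_symm, inner_e,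
    weightedPullback_apply, e_apply, lp.coeFn_smul, Pi.smul_apply, e_apply]
  by_cases h : σ k = l
  · simp [h]
  · simp [h, Ne.symm h]

theorem weightedPullback_e_map (hC : ∀ k, ‖w k‖ ≤ C) (k : Idx) :
    weightedPullback σ w C hC (e (σ k)) = w k • e k := by
  ext l
  rw [weightedPullback_apply, e_apply, lp.coeFn_smul, Pi.smul_apply, e_apply]
  by_cases h : l = k <;> simp [h]

theorem weightedPullback_e_of_notMem_range (hC : ∀ k, ‖w k‖ ≤ C) {l : Idx}
    (hl : l ∉ Set.range σ) : weightedPullback σ w C hC (e l) = 0 := by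
  ext k
  rw [weightedPullback_apply, e_apply, if_neg fun h => hl ⟨k, h⟩, mul_zero]
  rfl

theorem weightedPullback_mul_adjoint_e (hC : ∀ k, ‖w k‖ ≤ C) (k : Idx) :
    (weightedPullback σ w C hC * ContinuousLinearMap.adjoint (weightedPullback σ w C hC)) (e k) =
      (w k * conj (w k)) • e k := by
  rw [mul_apply_eq_comp, adjoint_weightedPullback_e, map_smul, weightedPullback_e_map, smul_smul,
    mul_comm]

theorem adjoint_mul_weightedPullback_e (hC : ∀ k, ‖w k‖ ≤ C) {d : Idx → ℂ}
    (hd : ∀ k, d (σ k) = w k * conj (w k)) (hd0 : ∀ l ∉ Set.range σ, d l = 0) (l : Idx) :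
    (ContinuousLinearMap.adjoint (weightedPullback σ w C hC) * weightedPullback σ w C hC) (e l) =
      d l • e l := by
  rw [mul_apply_eq_comp]
  by_cases hl : l ∈ Set.range σ
  · obtain ⟨k, rfl⟩ := hl
    rw [weightedPullback_e_map, map_smul, adjoint_weightedPullback_e, smul_smul, hd]
  · rw [weightedPullback_e_of_notMem_range hC hl, map_zero, hd0 l hl, zero_smul]

theorem commute_weightedPullback (hC : ∀ k, ‖w k‖ ≤ C) (hD : ∀ k, ‖v k‖ ≤ D)
    (hστ : ∀ k, τ (σ k) = σ (τ k)) (hwv : ∀ k, w k * v (σ k) = v k * w (τ k)) :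
    Commute (weightedPullback σ w C hC) (weightedPullback τ v D hD) := by
  refine ContinuousLinearMap.ext fun f => lp.ext (funext fun k => ?_)
  simp only [mul_apply_eq_comp, weightedPullback_apply, ← mul_assoc, hστ, hwv]

theorem isStarNormal_add {A : Type*} [Ring A] [StarRing A] {a b : A} (hab : Commute (star a) b)
    (h : star a * a + star b * b = a * star a + b * star b) : IsStarNormal (a + b) where
  star_comm_self := by
    have hab' : star b * a = a * star b := by
      rw [← star_inj, star_mul, star_mul, star_star, hab.eq]
    rw [commute_iff_eq, star_add]
    calc (star a + star b) * (a + b)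
        = (star a * a + star b * b) + (star a * b + star b * a) := by noncomm_ring
      _ = (a * star a + b * star b) + (b * star a + a * star b) := by rw [h, hab.eq, hab']
      _ = (a + b) * (star a + star b) := by noncomm_ring

theorem star_mul_self_pow {A : Type*} [Monoid A] [StarMul A] (a : A) [IsStarNormal a] (r : ℕ) :
    (star a * a) ^ r = star (a ^ r) * a ^ r := by
  rw [(star_comm_self (x := a)).mul_pow, star_pow]

end Operators

section Coefficients

variable {q : ℝ}

/-- Write `q = √Q`. The squares of the coefficients of `β` are `b_-(N, x, y)² = bSq Q N x y` and
`b_+(N, x, y)² = bSq Q (N + 1) y (x + 1)`. -/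
noncomputable def bSq (Q : ℝ) (N u v : ℕ) : ℝ :=
  (Q ^ u - Q ^ N) * (1 - Q ^ v) / ((1 - Q ^ N) * (1 - Q ^ (N + 1)))

theorem sq_mem_Ioo (hq : q ∈ Set.Ioo 0 1) : q ^ 2 ∈ Set.Ioo 0 1 :=
  ⟨pow_pos hq.1 2, pow_lt_one₀ hq.1.le hq.2 two_ne_zero⟩

theorem sq_sqrt_one_sub_pow (hq : q ∈ Set.Ioo 0 1) (n : ℕ) : √(1 - q ^ n) ^ 2 = 1 - q ^ n :=
  Real.sq_sqrt (sub_nonneg.mpr (pow_le_one₀ hq.1.le hq.2.le))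

theorem bMinus_sq (hq : q ∈ Set.Ioo 0 1) {N x : ℕ} (hx : x ≤ N) (y : ℕ) :
    bMinus q N x y ^ 2 = bSq (q ^ 2) N x y := by
  obtain ⟨m, rfl⟩ := Nat.exists_eq_add_of_le hx
  simp only [bMinus, bSq, div_pow, mul_pow, sq_sqrt_one_sub_pow hq, Nat.add_sub_cancel_left]
  ring

theorem bPlus_sq (hq : q ∈ Set.Ioo 0 1) {N y : ℕ} (hy : y ≤ N) (x : ℕ) :
    bPlus q N x y ^ 2 = bSq (q ^ 2) (N + 1) y (x + 1) := by
  obtain ⟨m, rfl⟩ := Nat.exists_eq_add_of_le hy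
  simp only [bPlus, bSq, div_pow, mul_pow, sq_sqrt_one_sub_pow hq, Nat.add_sub_cancel_left]
  ring

theorem bSq_self_left (Q : ℝ) (N v : ℕ) : bSq Q N N v = 0 := by simp [bSq]

theorem bSq_zero_right (Q : ℝ) (N u : ℕ) : bSq Q N u 0 = 0 := by simp [bSq]

theorem bSq_add_eq {Q : ℝ} (hQ : Q ∈ Set.Ioo 0 1) {N x y : ℕ} (hx : x ≤ N) (hy : y ≤ N) :
    bSq Q (N + 1) y (x + 1) + bSq Q N x y = bSq Q N y x + bSq Q (N + 1) x (y + 1) := by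
  have hne : ∀ n ≠ 0, 1 - Q ^ n ≠ 0 := fun n hn => (sub_pos.mpr (pow_lt_one₀ hQ.1.le hQ.2 hn)).ne'
  rcases eq_or_ne N 0 with rfl | hN
  · rw [Nat.le_zero.mp hx, Nat.le_zero.mp hy]
    ring
  · have h0 := hne N hN
    have h1 := hne (N + 1) N.succ_ne_zero
    have h2 := hne (N + 2) (N + 1).succ_ne_zero
    simp only [bSq, add_assoc, one_add_one_eq_two]
    field_simp
    ring

theorem bPlus_mul_bMinus (q : ℝ) (N x y : ℕ) :
    bPlus q N x y * bMinus q (N + 2) (x + 1) (y + 1) =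
      bMinus q (N + 1) x (y + 1) * bPlus q (N + 1) x (y + 1) := by
  simp only [bPlus, bMinus, Nat.add_sub_add_right, show N + 2 - (x + 1) = N + 1 - x by omega,
    mul_add, mul_one]
  ring

theorem notMem_range_shiftX {k : Idx} (hk : k ∉ Set.range shiftX) :
    (k.2.1 : ℕ) = 0 ∨ (k.2.2 : ℕ) = k.1 := by
  obtain ⟨_ | N, x, y⟩ := k
  · exact .inl (Nat.lt_one_iff.mp x.2)
  · induction x using Fin.cases with
    | zero => exact .inl rfl
    | succ x =>
      induction y using Fin.lastCases with
      | last => exact .inr rfl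
      | cast y => exact (hk ⟨⟨N, x, y⟩, rfl⟩).elim

theorem notMem_range_shiftY {k : Idx} (hk : k ∉ Set.range shiftY) :
    (k.2.1 : ℕ) = k.1 ∨ (k.2.2 : ℕ) = 0 := by
  obtain ⟨_ | N, x, y⟩ := k
  · exact .inr (Nat.lt_one_iff.mp y.2)
  · induction y using Fin.cases with
    | zero => exact .inr rfl
    | succ y =>
      induction x using Fin.lastCases with
      | last => exact .inl rfl
      | cast x => exact (hk ⟨⟨N, x, y⟩, rfl⟩).elim

end Coefficients

section Beta

theorem ofReal_mul_conj (b : ℝ) : (b : ℂ) * conj (b : ℂ) = ((b ^ 2 : ℝ) : ℂ) := by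
  rw [Complex.conj_ofReal, ← Complex.ofReal_mul, sq]

variable (q : Set.Ioo (0 : ℝ) 1)

theorem star_betaPlus_mul_betaPlus_e (k : Idx) :
    (star (betaPlus q) * betaPlus q) (e k) =
      (bSq ((q : ℝ) ^ 2) (k.1 + 1) k.2.2 (k.2.1 + 1) : ℂ) • e k := by
  rw [← bPlus_sq q.2 (Nat.le_of_lt_succ k.2.2.2), ← ofReal_mul_conj, betaPlus,
    ← ContinuousLinearMap.star_eq_adjoint, star_star]
  exact weightedPullback_mul_adjoint_e _ k

theorem betaPlus_mul_star_betaPlus_e (k : Idx) :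
    (betaPlus q * star (betaPlus q)) (e k) =
      (bSq ((q : ℝ) ^ 2) k.1 k.2.2 k.2.1 : ℂ) • e k := by
  rw [betaPlus, ← ContinuousLinearMap.star_eq_adjoint, star_star]
  refine adjoint_mul_weightedPullback_e (norm_bPlus_le q)
    (d := fun k => (bSq ((q : ℝ) ^ 2) k.1 k.2.2 k.2.1 : ℂ)) (fun k => ?_) (fun k hk => ?_) k
  · rw [ofReal_mul_conj, bPlus_sq q.2 (Nat.le_of_lt_succ k.2.2.2)]
    rfl
  · rcases notMem_range_shiftX hk with h | h <;>
      simp only [h, bSq_self_left, bSq_zero_right, Complex.ofReal_zero]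

theorem betaMinus_mul_star_betaMinus_e (k : Idx) :
    (betaMinus q * star (betaMinus q)) (e k) =
      (bSq ((q : ℝ) ^ 2) (k.1 + 1) k.2.1 (k.2.2 + 1) : ℂ) • e k := by
  rw [← bMinus_sq q.2 k.2.1.2.le, ← ofReal_mul_conj]
  exact weightedPullback_mul_adjoint_e _ k

theorem star_betaMinus_mul_betaMinus_e (k : Idx) :
    (star (betaMinus q) * betaMinus q) (e k) =
      (bSq ((q : ℝ) ^ 2) k.1 k.2.1 k.2.2 : ℂ) • e k := by
  refine adjoint_mul_weightedPullback_e (norm_bMinus_le q)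
    (d := fun k => (bSq ((q : ℝ) ^ 2) k.1 k.2.1 k.2.2 : ℂ)) (fun k => ?_) (fun k hk => ?_) k
  · rw [ofReal_mul_conj, bMinus_sq q.2 k.2.1.2.le]
    rfl
  · rcases notMem_range_shiftY hk with h | h <;>
      simp only [h, bSq_self_left, bSq_zero_right, Complex.ofReal_zero]

theorem commute_star_betaPlus_betaMinus : Commute (star (betaPlus q)) (betaMinus q) := by
  rw [betaPlus, ← ContinuousLinearMap.star_eq_adjoint, star_star]
  exact commute_weightedPullback _ _ (fun _ => rfl) fun _ => by
    exact_mod_cast bPlus_mul_bMinus (q : ℝ) _ _ _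

instance isStarNormal_beta : IsStarNormal (beta q) := by
  refine isStarNormal_add (commute_star_betaPlus_betaMinus q) (clm_ext_e fun k => ?_)
  simp only [_root_.add_apply, star_betaPlus_mul_betaPlus_e, betaPlus_mul_star_betaPlus_e,
    star_betaMinus_mul_betaMinus_e, betaMinus_mul_star_betaMinus_e, ← add_smul,
    ← Complex.ofReal_add, bSq_add_eq (sq_mem_Ioo q.2) (Nat.le_of_lt_succ k.2.1.2)
      (Nat.le_of_lt_succ k.2.2.2)]

end Beta

section DiagonalCoefficients

theorem ev_of_le {N x y : ℕ} (hx : x ≤ N) (hy : y ≤ N) :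
    ev N x y = e ⟨N, ⟨x, Nat.lt_succ_of_le hx⟩, ⟨y, Nat.lt_succ_of_le hy⟩⟩ :=
  dif_pos ⟨Nat.lt_succ_of_le hx, Nat.lt_succ_of_le hy⟩

theorem beta_ev_self (q : Set.Ioo (0 : ℝ) 1) {N y : ℕ} (hy : y ≤ N) :
    beta q (ev N N y) = (bPlus q N N y : ℂ) • ev (N + 1) (N + 1) y := by
  have hb : bMinus q N N y = 0 := by simp [bMinus]
  rw [beta_ev q N N y le_rfl hy, hb, Complex.ofReal_zero, zero_smul, add_zero]

theorem beta_pow_ev_self (q : Set.Ioo (0 : ℝ) 1) {N y : ℕ} (hy : y ≤ N) (r : ℕ) :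
    (beta q ^ r) (ev N N y) =
      ((∏ t ∈ range r, bPlus q (N + t) (N + t) y : ℝ) : ℂ) • ev (N + r) (N + r) y := by
  induction r with
  | zero => simp
  | succ r ih =>
    rw [pow_succ', mul_apply_eq_comp, ih, map_smul,
      beta_ev_self q (hy.trans (Nat.le_add_right N r)), smul_smul, prod_range_succ,
      Complex.ofReal_mul, add_assoc]

theorem inner_star_mul_self_pow_ev_self (q : Set.Ioo (0 : ℝ) 1) {N y : ℕ} (hy : y ≤ N) (r : ℕ) :
    inner ℂ (ev N N y) (((star (beta q) * beta q) ^ r) (ev N N y)) =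
      ((∏ t ∈ range r, bPlus q (N + t) (N + t) y ^ 2 : ℝ) : ℂ) := by
  have hle : y ≤ N + r := hy.trans (Nat.le_add_right N r)
  rw [star_mul_self_pow, mul_apply_eq_comp, ContinuousLinearMap.star_eq_adjoint,
    ContinuousLinearMap.adjoint_inner_right, beta_pow_ev_self q hy, inner_smul_left,
    inner_smul_right, ev_of_le le_rfl hle, inner_e, e_apply, if_pos rfl, mul_one, mul_comm,
    ofReal_mul_conj, prod_pow]

theorem bPlus_sq_self {q : ℝ} (hq : q ∈ Set.Ioo 0 1) (y m : ℕ) :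
    bPlus q (y + m) (y + m) y ^ 2 =
      (q ^ 2) ^ y * (1 - (q ^ 2) ^ (m + 1)) / (1 - (q ^ 2) ^ (y + m + 2)) := by
  have hne : 1 - (q ^ 2) ^ (y + m + 1) ≠ 0 :=
    (sub_pos.mpr (pow_lt_one₀ (sq_mem_Ioo hq).1.le (sq_mem_Ioo hq).2 (by omega))).ne'
  rw [bPlus_sq hq (Nat.le_add_right y m), bSq, mul_comm (1 - (q ^ 2) ^ (y + m + 1)),
    mul_div_mul_right _ _ hne]
  ring

theorem prod_bPlus_sq_self {q : ℝ} (hq : q ∈ Set.Ioo 0 1) (r y m : ℕ) :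
    ∏ t ∈ range r, bPlus q (y + m + t) (y + m + t) y ^ 2 =
      (q ^ 2) ^ (y * r) * qPochhammer ((q ^ 2) ^ (m + 1)) (q ^ 2) r /
        qPochhammer ((q ^ 2) ^ (y + m + 2)) (q ^ 2) r := by
  simp only [add_assoc, bPlus_sq_self hq, prod_div_distrib, prod_mul_distrib, prod_const,
    card_range, qPochhammer, ← pow_add, ← pow_mul]
  ring_nf

end DiagonalCoefficients

section Trace

variable {ε : ℝ}

/-- The eigenvalue of `|D|` on the vectors `e_{ij}^{(n)}` with `N = 2n`. -/
noncomputable def absEigen (ε : ℝ) (N : ℕ) : ℝ := if N = 0 then ε else N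

theorem absEigen_pos (hε : 0 < ε) (N : ℕ) : 0 < absEigen ε N := by
  rw [absEigen]
  split_ifs with h
  · exact hε
  · exact_mod_cast Nat.pos_of_ne_zero h

theorem absDEigen_eq_absEigen (ε : ℝ) (k : Idx) : absDEigen ε k = absEigen ε k.1 := by
  rw [absDEigen, absEigen, dEigen, fEigen]
  split_ifs <;> simp_all

theorem norm_absEigen_cpow_neg (hε : 0 < ε) (N : ℕ) (s : ℂ) :
    ‖(absEigen ε N : ℂ) ^ (-s)‖ = absEigen ε N ^ (-s.re) := by
  rw [Complex.norm_cpow_eq_rpow_re_of_pos (absEigen_pos hε N), Complex.neg_re]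

theorem absDPow_e (hε : 0 < ε) {s : ℂ} (hs : 0 ≤ s.re) (k : Idx) :
    absDPow ε s (e k) = ((absEigen ε k.1 : ℂ) ^ (-s)) • e k := by
  rw [absDPow, diagOp_e, absDEigen_eq_absEigen]
  refine ⟨max 1 (ε ^ (-s.re)), fun k => ?_⟩
  rw [absDEigen_eq_absEigen, norm_absEigen_cpow_neg hε, absEigen]
  split_ifs with h
  · exact le_max_right _ _
  · refine le_max_of_le_left (Real.rpow_le_one_of_one_le_of_nonpos ?_ (neg_nonpos.mpr hs))
    exact_mod_cast Nat.one_le_iff_ne_zero.mpr h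

theorem P_e (k : Idx) : P (e k) = (if (k.2.1 : ℕ) = k.1 then 1 else 0 : ℂ) • e k := by
  have hF : F (e k) = (fEigen k : ℂ) • e k := by
    refine diagOp_e _ ⟨1, fun k => ?_⟩ k
    rw [fEigen]
    split_ifs <;> simp
  rw [P, _root_.smul_apply, _root_.add_apply, one_apply_eq_self, hF, fEigen]
  split_ifs <;> push_cast <;> module

theorem summable_sq_mul_absEigen_rpow (hε : 0 < ε) {σ : ℝ} (hσ : 3 < σ) :
    Summable fun N : ℕ => ((N : ℝ) + 1) ^ 2 * absEigen ε N ^ (-σ) := by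
  rw [← summable_nat_add_iff 1]
  have h : Summable fun N : ℕ => 4 * ((N + 1 : ℕ) : ℝ) ^ (2 - σ) :=
    ((summable_nat_add_iff 1).mpr (Real.summable_nat_rpow.mpr (by linarith))).mul_left 4
  refine Summable.of_nonneg_of_le
    (fun N => mul_nonneg (sq_nonneg _) (Real.rpow_nonneg (absEigen_pos hε _).le _))
    (fun N => ?_) h
  have hN : (0 : ℝ) < ((N + 1 : ℕ) : ℝ) := by positivity
  have h1 : (1 : ℝ) ≤ ((N + 1 : ℕ) : ℝ) := by exact_mod_cast Nat.le_add_left 1 N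
  rw [absEigen, if_neg (Nat.succ_ne_zero N), sub_eq_add_neg, Real.rpow_add hN, ← mul_assoc,
    Real.rpow_ofNat]
  refine mul_le_mul_of_nonneg_right ?_ (by positivity)
  nlinarith

theorem summable_absEigen_rpow (hε : 0 < ε) {σ : ℝ} (hσ : 3 < σ) :
    Summable fun k : Idx => absEigen ε k.1 ^ (-σ) := by
  refine (summable_sigma_of_nonneg fun k => Real.rpow_nonneg (absEigen_pos hε _).le _).mpr
    ⟨fun N => Summable.of_finite, ?_⟩
  refine (summable_sq_mul_absEigen_rpow hε hσ).congr fun N => ?_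
  simp only [tsum_fintype, sum_const, card_univ, Fintype.card_prod, Fintype.card_fin,
    nsmul_eq_mul]
  push_cast
  ring

theorem norm_e (k : Idx) : ‖e k‖ = 1 := by simp [e, lp.norm_single]

theorem norm_apply_e_le (a : H →L[ℂ] H) (k : Idx) : ‖a (e k)‖ ≤ ‖a‖ := by
  simpa only [norm_e, mul_one] using a.le_opNorm (e k)

theorem norm_inner_apply_e_le (a : H →L[ℂ] H) (k : Idx) :
    ‖inner ℂ (e k) (a (e k))‖ ≤ ‖a‖ :=
  (norm_inner_le_norm _ _).trans <| by
    rw [norm_e, one_mul]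
    exact norm_apply_e_le a k

theorem isHilbertSchmidt_mul_absDPow (hε : 0 < ε) (a : H →L[ℂ] H) {s : ℂ}
    (hs : 3 < 2 * s.re) : IsHilbertSchmidt (a * absDPow ε s) := by
  refine Summable.of_nonneg_of_le (fun k => sq_nonneg _) (fun k => ?_)
    ((summable_absEigen_rpow hε hs).mul_left (‖a‖ ^ 2))
  have hsq : (absEigen ε k.1 ^ (-s.re)) ^ 2 = absEigen ε k.1 ^ (-(2 * s.re)) := by
    rw [← Real.rpow_mul_natCast (absEigen_pos hε _).le]
    congr 1
    push_cast
    ring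
  rw [mul_apply_eq_comp, absDPow_e hε (by linarith), map_smul, norm_smul,
    norm_absEigen_cpow_neg hε, mul_pow, mul_comm, hsq]
  have hpos := Real.rpow_nonneg (absEigen_pos hε k.1).le (-(2 * s.re))
  gcongr
  exact norm_apply_e_le a k

theorem absDPow_add (hε : 0 < ε) {s t : ℂ} (hs : 0 ≤ s.re) (ht : 0 ≤ t.re) :
    absDPow ε (s + t) = absDPow ε s * absDPow ε t := clm_ext_e fun k => by
  have hne : (absEigen ε k.1 : ℂ) ≠ 0 := by exact_mod_cast (absEigen_pos hε _).ne'
  have hst : 0 ≤ (s + t).re := add_nonneg hs ht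
  rw [mul_apply_eq_comp, absDPow_e hε hst, absDPow_e hε ht, map_smul, absDPow_e hε hs, smul_smul,
    ← Complex.cpow_add _ _ hne, neg_add_rev]

theorem isTraceClass_mul_absDPow (hε : 0 < ε) (a : H →L[ℂ] H) {s : ℂ}
    (hs : 3 < s.re) : IsTraceClass (a * absDPow ε s) := by
  have h2 : 3 < 2 * (s / 2).re := by
    rw [Complex.div_ofNat_re]
    linarith
  refine ⟨a * absDPow ε (s / 2), 1 * absDPow ε (s / 2), isHilbertSchmidt_mul_absDPow hε a h2,
    isHilbertSchmidt_mul_absDPow hε 1 h2, ?_⟩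
  rw [one_mul, mul_assoc, ← absDPow_add hε (by linarith) (by linarith), add_halves]

theorem inner_mul_P_mul_absDPow_e (hε : 0 < ε) (a : H →L[ℂ] H) {s : ℂ} (hs : 0 ≤ s.re)
    (k : Idx) : inner ℂ (e k) ((a * P * absDPow ε s) (e k)) =
      if (k.2.1 : ℕ) = k.1 then (absEigen ε k.1 : ℂ) ^ (-s) * inner ℂ (e k) (a (e k)) else 0 := by
  rw [mul_apply_eq_comp, mul_apply_eq_comp, absDPow_e hε hs, map_smul, P_e, map_smul,
    map_smul, inner_smul_right, inner_smul_right]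
  split_ifs <;> simp

theorem summable_inner_mul_P_mul_absDPow_e (hε : 0 < ε) (a : H →L[ℂ] H) {s : ℂ}
    (hs : 3 < s.re) : Summable fun k => inner ℂ (e k) ((a * P * absDPow ε s) (e k)) := by
  refine .of_norm_bounded ((summable_absEigen_rpow hε hs).mul_left ‖a‖) fun k => ?_
  have hpos := Real.rpow_nonneg (absEigen_pos hε k.1).le (-s.re)
  rw [inner_mul_P_mul_absDPow_e hε a (by linarith)]
  split_ifs
  · rw [norm_mul, norm_absEigen_cpow_neg hε, mul_comm]
    exact mul_le_mul_of_nonneg_right (norm_inner_apply_e_le a k) hpos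
  · rw [norm_zero]
    positivity

/-- The sum of the diagonal matrix coefficients of `a` at the vectors `e_{nj}^{(n)}` with
`N = 2n`. -/
noncomputable def levelTrace (a : H →L[ℂ] H) (N : ℕ) : ℂ :=
  ∑ y ∈ range (N + 1), inner ℂ (ev N N y) (a (ev N N y))

theorem sum_inner_mul_P_mul_absDPow_e (hε : 0 < ε) (a : H →L[ℂ] H) {s : ℂ} (hs : 0 ≤ s.re)
    (N : ℕ) : ∑ c, inner ℂ (e ⟨N, c⟩) ((a * P * absDPow ε s) (e ⟨N, c⟩)) =
      (absEigen ε N : ℂ) ^ (-s) * levelTrace a N := by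
  rw [levelTrace, sum_range, mul_sum, Fintype.sum_prod_type_right]
  refine sum_congr rfl fun y _ => ?_
  rw [Fintype.sum_eq_single (Fin.last N)]
  · rw [inner_mul_P_mul_absDPow_e hε a hs, if_pos (Fin.val_last N),
      ev_of_le le_rfl (Nat.le_of_lt_succ y.2)]
    rfl
  · intro x hx
    rw [inner_mul_P_mul_absDPow_e hε a hs]
    exact if_neg fun h => hx (Fin.ext h)

theorem hasSum_trace (hε : 0 < ε) (a : H →L[ℂ] H) {s : ℂ} (hs : 3 < s.re) :
    HasSum (fun N => (absEigen ε N : ℂ) ^ (-s) * levelTrace a N)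
      (trace (a * P * absDPow ε s)) := by
  simp only [← sum_inner_mul_P_mul_absDPow_e hε a (by linarith : 0 ≤ s.re)]
  exact (summable_inner_mul_P_mul_absDPow_e hε a hs).hasSum.sigma fun N => hasSum_fintype _

theorem levelTrace_star_mul_self_pow (q : Set.Ioo (0 : ℝ) 1) (r N : ℕ) :
    levelTrace ((star (beta q) * beta q) ^ r) N = momentSum (((q : ℝ) : ℂ) ^ 2) r N := by
  rw [momentSum, pochhammerSum, sum_div, Nat.sum_antidiagonal_eq_sum_range_succ_mk]
  refine sum_congr rfl fun y hy => ?_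
  obtain ⟨m, rfl⟩ := Nat.exists_eq_add_of_le (mem_range_succ_iff.mp hy)
  rw [inner_star_mul_self_pow_ev_self q (Nat.le_add_right y m), prod_bPlus_sq_self q.2]
  simp only [Nat.add_sub_cancel_left, qPochhammer]
  push_cast
  rfl

/-- The meromorphic continuation of `s ↦ Trace (a P |D|^{-s})` for an operator `a` whose level
traces are `K + d N`, with `d` rapidly decreasing. -/
noncomputable def zetaContinuation (ε : ℝ) (K : ℂ) (d : ℕ → ℂ) (s : ℂ) : ℂ :=
  (K + d 0) * (ε : ℂ) ^ (-s) + K * riemannZeta s + LSeries d s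

theorem analyticAt_cpow_neg (hε : 0 < ε) (s : ℂ) :
    AnalyticAt ℂ (fun s : ℂ => (ε : ℂ) ^ (-s)) s :=
  analyticAt_const.cpow analyticAt_id.neg (Complex.ofReal_mem_slitPlane.mpr hε)

theorem analyticAt_LSeries_of_abscissaOfAbsConv_eq_bot {d : ℕ → ℂ}
    (hd : LSeries.abscissaOfAbsConv d = ⊥) (s : ℂ) : AnalyticAt ℂ (LSeries d) s :=
  LSeries_analyticOnNhd d s <| by
    rw [Set.mem_ofPred_eq, hd]
    exact EReal.bot_lt_coe _

theorem absEigen_cpow_neg_mul (ε : ℝ) (K : ℂ) (d : ℕ → ℂ) (s : ℂ) (N : ℕ) :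
    (absEigen ε N : ℂ) ^ (-s) * (K + d N) =
      (if N = 0 then (K + d 0) * (ε : ℂ) ^ (-s) else 0) + K * LSeries.term 1 s N +
        LSeries.term d s N := by
  rcases eq_or_ne N 0 with rfl | hN
  · simp [absEigen, mul_comm]
  · rw [LSeries.term_of_ne_zero hN, LSeries.term_of_ne_zero hN, absEigen, if_neg hN, if_neg hN,
      Complex.cpow_neg, Complex.ofReal_natCast, Pi.one_apply]
    ring

theorem hasSum_zetaContinuation (ε : ℝ) (K : ℂ) {d : ℕ → ℂ} {s : ℂ} (hs : 1 < s.re)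
    (hd : LSeriesSummable d s) :
    HasSum (fun N => (absEigen ε N : ℂ) ^ (-s) * (K + d N)) (zetaContinuation ε K d s) := by
  simp only [absEigen_cpow_neg_mul]
  exact ((hasSum_ite_eq 0 _).add ((LSeriesHasSum_one hs).mul_left K)).add hd.LSeriesHasSum

theorem isEtaZeta_zetaContinuation (hε : 0 < ε) {a : H →L[ℂ] H} {K : ℂ} {d : ℕ → ℂ}
    (hd : LSeries.abscissaOfAbsConv d = ⊥) (ha : ∀ N, levelTrace a N = K + d N) :
    IsEtaZeta ε a (zetaContinuation ε K d) where
  meromorphic s :=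
    ((analyticAt_const.mul (analyticAt_cpow_neg hε s)).meromorphicAt.add
      ((MeromorphicAt.const K s).mul (meromorphic_riemannZeta s))).add
        (analyticAt_LSeries_of_abscissaOfAbsConv_eq_bot hd s).meromorphicAt
  analyticAt_zero :=
    ((analyticAt_const.mul (analyticAt_cpow_neg hε 0)).add (analyticAt_const.mul
      (analyticOn_riemannZeta 0 zero_ne_one))).add
        (analyticAt_LSeries_of_abscissaOfAbsConv_eq_bot hd 0)
  isTraceClass _ hs := isTraceClass_mul_absDPow hε _ hs
  eq_trace s hs := by
    have hsum : LSeriesSummable d s := LSeriesSummable_of_abscissaOfAbsConv_lt_re <| by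
      rw [hd]
      exact EReal.bot_lt_coe _
    refine HasSum.unique ?_ (hasSum_trace hε a hs)
    simpa only [ha] using hasSum_zetaContinuation ε K (by linarith) hsum

theorem zetaContinuation_zero (ε : ℝ) (K : ℂ) {d : ℕ → ℂ}
    (hd : LSeries.abscissaOfAbsConv d < 0) :
    zetaContinuation ε K d 0 = 1 / 2 * K + ∑' N, d N := by
  rw [zetaContinuation, LSeries_zero_of_abscissaOfAbsConv_lt_zero hd, riemannZeta_zero,
    (summable_of_abscissaOfAbsConv_lt_zero hd).tsum_eq_zero_add, neg_zero, Complex.cpow_zero]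
  ring

end Trace

end SUq2

theorem theorem6 :
    (∀ τ : ℂ, 0 < τ.im →
      logDeriv ModularForm.eta τ =
        2 * Real.pi * Complex.I *
          (1 / 24 - SUq2.G (Complex.exp (2 * Real.pi * Complex.I * τ)))) ∧
    ∀ r : ℕ, 1 ≤ r →
      ∃ R : RatFunc ℂ,
        (∀ z : ℂ, R.denom.eval z = 0 → ∃ k : ℕ, 0 < k ∧ z ^ k = 1) ∧
        ∀ (q : Set.Ioo (0 : ℝ) 1) (ε : ℝ), 0 < ε →
          (∃ Z : ℂ → ℂ, SUq2.IsEtaZeta ε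
            ((ContinuousLinearMap.adjoint (SUq2.beta q) * SUq2.beta q) ^ r) Z) ∧
          (1 / 2 : ℂ) * SUq2.psi0 ε
              ((ContinuousLinearMap.adjoint (SUq2.beta q) * SUq2.beta q) ^ r) =
            (((q : ℝ) : ℂ) ^ (2 * r))⁻¹ *
              (((q : ℝ) : ℂ) ^ 2 * R.eval (RingHom.id ℂ) (((q : ℝ) : ℂ) ^ 2)
                - SUq2.G (((q : ℝ) : ℂ) ^ 2)) := by
  refine ⟨SUq2.logDeriv_eta_eq, fun r hr => ?_⟩
  obtain ⟨s, rfl⟩ := Nat.exists_eq_add_of_le' hr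
  refine ⟨SUq2.etaRatFunc s,
    fun z hz => isOfFinOrder_iff_pow_eq_one.mp ((SUq2.etaRatFunc s).2 z hz), fun q ε hε => ?_⟩
  have hx0 : ((q : ℝ) : ℂ) ^ 2 ≠ 0 := pow_ne_zero 2 (Complex.ofReal_ne_zero.mpr q.2.1.ne')
  have hx : ‖((q : ℝ) : ℂ) ^ 2‖ < 1 := by
    rw [norm_pow, Complex.norm_of_nonneg q.2.1.le]
    exact (SUq2.sq_mem_Ioo q.2).2
  have hd := SUq2.abscissaOfAbsConv_deviation hx0 hx hr
  have hZ := SUq2.isEtaZeta_zetaContinuation hε hd fun N =>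
    (SUq2.levelTrace_star_mul_self_pow q (s + 1) N).trans (add_sub_cancel _ _).symm
  rw [← ContinuousLinearMap.star_eq_adjoint]
  refine ⟨⟨_, hZ⟩, ?_⟩
  rw [SUq2.psi0_eq hZ, SUq2.zetaContinuation_zero ε _ (hd.trans_lt EReal.bot_lt_zero),
    ← SUq2.pow_mul_regularizedSum hx0 hx, pow_mul, inv_mul_cancel_left₀ (pow_ne_zero _ hx0)]
  ring
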